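/- Let $y_1<y_2$ be real numbers, let $c\in(0,1)$ and $M_c=y_1+c(y_2-y_1)$. For $\tau>0$ and $x\in(y_1,y_2)$ the central similarity proximity region is $$N(x,\tau,c)=\begin{cases}\left(x-\tau(x-y_1),\,x+\frac{\tau(1-c)(x-y_1)}{c}\right)\cap(y_1,y_2), & x\le M_c,\\[2pt] \left(x-\frac{c\,\tau(y_2-x)}{1-c},\,x+\tau(y_2-x)\right)\cap(y_1,y_2), & x\ge M_c\end{cases}$$ (the two formulas agree at $x=M_c$). For each $n$ let $X_1,\dots,X_n$ be independent random variables, uniformly distributed on $(y_1,y_2)$. The central similarity proximity catch digraph has vertices $X_1,\dots,X_n$ and an arc from $X_i$ to $X_j$, $i\ne j$, if and only if $X_j\in N(X_i,\tau,c)$. Its relative density $\rho_{n,2}(\tau,c)$ is the number of arcs divided by $n(n-1)$ (and is $0$ for $n\le 1$). Let $\mu(\tau,c)=P(X_2\in N(X_1,\tau,c))$ be the arc probability, let $h_{ij}=\frac12\left(\mathbf 1\{X_j\in N(X_i,\tau,c)\}+\mathbf 1\{X_i\in N(X_j,\tau,c)\}\right)$, and let $\nu(\tau,c)=\operatorname{Cov}(h_{12},h_{13})$.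 Then for $\tau=1$ and every $c\in(0,1)$, $$\sqrt n\,\bigl[\rho_{n,2}(1,c)-\mu(1,c)\bigr]\xrightarrow{\ \mathcal L\ }\mathcal N\bigl(0,4\,\nu(1,c)\bigr)\quad\text{as } n\to\infty,$$ where $\mu(1,c)=\frac12$ and $4\,\nu(1,c)=\frac{c(1-c)}{3}$. -/

import Mathlib

open MeasureTheory ProbabilityTheory Filter Set

noncomputable section

namespace CentralSimilarity

open scoped Classical in
/-- The central similarity proximity region of a point `x` with expansion parameter `τ` and
centrality parameter `c`, for the two reference points `y₁ < y₂`.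

The reference points cut the line into the end intervals `(-∞, y₁)`, `(y₂, ∞)` and the middle
interval `(y₁, y₂)`; a reference point has region `{x}`. The point
`M = y₁ + c (y₂ - y₁)` is the centre of the middle interval. At `x = M` both formulas for the
middle interval give the same set, so the choice between them does not matter. -/
def proximityRegion (y₁ y₂ τ c x : ℝ) : Set ℝ :=
  if x < y₁ then
    Ioo (x - τ * (y₁ - x)) (x + τ * (y₁ - x)) ∩ Iio y₁
  else if y₂ < x then
    Ioo (x - τ * (x - y₂)) (x + τ * (x - y₂)) ∩ Ioi y₂
  else if x = y₁ ∨ x = y₂ then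
    {x}
  else if x < y₁ + c * (y₂ - y₁) then
    Ioo (x - τ * (x - y₁)) (x + τ * (1 - c) * (x - y₁) / c) ∩ Ioo y₁ y₂
  else
    Ioo (x - c * τ * (y₂ - x) / (1 - c)) (x + τ * (y₂ - x)) ∩ Ioo y₁ y₂

/-- The central similarity proximity catch digraph on the vertices `x 0, …, x (n - 1)`, indexed
by `Fin n`: there is an arc from `i` to `j ≠ i` iff `x j` lies in the proximity region of `x i`. -/
def catchDigraph (y₁ y₂ τ c : ℝ) {n : ℕ} (x : Fin n → ℝ) : Digraph (Fin n) where
  Adj i j := i ≠ j ∧ x j ∈ proximityRegion y₁ y₂ τ c (x i)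

/-- The number of arcs of a digraph. -/
def arcCount {V : Type*} (D : Digraph V) : ℕ :=
  {p : V × V | D.Adj p.1 p.2}.ncard

/-- The three intervals into which the reference points `y₁ < y₂` partition the line. -/
def interval (y₁ y₂ : ℝ) : Fin 3 → Set ℝ :=
  ![Iio y₁, Ioo y₁ y₂, Ioi y₂]

/-- The largest possible number of arcs: `∑ᵢ nᵢ (nᵢ - 1)`, with `nᵢ` the number of points
in the `i`-th interval. -/
def maxArcCount (y₁ y₂ : ℝ) {n : ℕ} (x : Fin n → ℝ) : ℕ :=
  ∑ i : Fin 3, {k | x k ∈ interval y₁ y₂ i}.ncard * ({k | x k ∈ interval y₁ y₂ i}.ncard - 1)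

/-- The relative density of the digraph: the number of arcs over the largest possible number
of arcs (and `0` when no two points share an interval). -/
def relativeDensity (y₁ y₂ τ c : ℝ) {n : ℕ} (x : Fin n → ℝ) : ℝ :=
  (arcCount (catchDigraph y₁ y₂ τ c x) : ℝ) / (maxArcCount y₁ y₂ x : ℝ)

/-- The uniform distribution on the interval `(y₁, y₂)`. -/
def uniform (y₁ y₂ : ℝ) : Measure ℝ :=
  ProbabilityTheory.cond volume (Ioo y₁ y₂)

/-- The arc probability `μ(τ, c) = P(X₂ ∈ N(X₁))` for independent uniform `X₁`, `X₂`. -/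
def arcProbability (y₁ y₂ τ c : ℝ) : ℝ :=
  ((uniform y₁ y₂).prod (uniform y₁ y₂)).real {p | p.2 ∈ proximityRegion y₁ y₂ τ c p.1}

/-- Half the number of arcs (in either direction) between two points `a` and `b`. -/
def halfArcs (y₁ y₂ τ c a b : ℝ) : ℝ :=
  ((proximityRegion y₁ y₂ τ c a).indicator 1 b + (proximityRegion y₁ y₂ τ c b).indicator 1 a) / 2

/-- The covariance `ν(τ, c) = Cov(h₁₂, h₁₃)`, where `hᵢⱼ` is half the number of arcs between `Xᵢ`
and `Xⱼ`, for independent uniform `X₁`, `X₂`, `X₃`. -/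
def arcCovariance (y₁ y₂ τ c : ℝ) : ℝ :=
  covariance (fun x : Fin 3 → ℝ => halfArcs y₁ y₂ τ c (x 0) (x 1))
    (fun x : Fin 3 → ℝ => halfArcs y₁ y₂ τ c (x 0) (x 2))
    (Measure.pi fun _ : Fin 3 => uniform y₁ y₂)

end CentralSimilarity

end

/-! Almost surely all points lie in `(y₁, y₂)`, and the relative density is then the average of the
arc indicator `a(Xᵢ, Xⱼ)` over ordered pairs of distinct indices: a U-statistic of order two with a
bounded, non-symmetric kernel.

Hoeffding's decomposition, with `θ = E a(X₁, X₂)` and `φ(x) = E a(x, X) + E a(X, x)`, splits the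
centred average into `n⁻¹ ∑ (φ(Xᵢ) - 2θ)` and an average of a completely degenerate kernel
(`pairAverage_sub_eq`). The degenerate summands at two pairs are orthogonal unless the pairs have
the same underlying set, so after scaling by `√n` that part has second moment `O(1/n)`
(`integral_sq_sum_offDiag_le`). The classical CLT for `φ(Xᵢ)` and Slutsky's argument give a normal
limit with variance `Var φ(X)`, which is `4ν` because the projection of the symmetrised kernel is
`φ/2` (`four_mul_arcCovariance`).

For `τ = 1`, in the coordinate `t = (x - y₁)/(y₂ - y₁)`, the outgoing arc probability from `x` is
the tent function with peak at `c`, and the incoming one is the linear function `c + (1 - 2c)t`.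
Integrating these piecewise polynomials yields `θ = 1/2` and `Var φ(X) = c(1-c)/3`. -/

/-! ### Hoeffding decomposition and orthogonality -/

section UStatistic

open scoped Topology

variable {E G Ω : Type*} [MeasurableSpace E] [MeasurableSpace G] [MeasurableSpace Ω]
  {P : Measure Ω} {μ : Measure E} {ι : Type*} {X : ι → Ω → E}

/-- Only `i` has to avoid the other indices; `j`, `k`, `l` may coincide. This covers products of
kernels at overlapping pairs. -/
lemma indepFun_of_iIndepFun_of_ne (hlaw : ∀ i, HasLaw (X i) μ P) (hX : iIndepFun X P)
    {i j k l : ι} (hj : i ≠ j) (hk : i ≠ k) (hl : i ≠ l) :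
    IndepFun (X i) (fun ω => (X j ω, X k ω, X l ω)) P := by
  classical
  have h := hX.indepFun_finset₀ {i} {j, k, l} (by simp [hj, hk, hl])
    (fun i => (hlaw i).aemeasurable)
  exact h.comp (φ := fun f : ({i} : Finset ι) → E => f ⟨i, by simp⟩)
    (ψ := fun f : ({j, k, l} : Finset ι) → E =>
      (f ⟨j, by simp⟩, f ⟨k, by simp⟩, f ⟨l, by simp⟩)) (by fun_prop) (by fun_prop)

variable [IsProbabilityMeasure P] [IsProbabilityMeasure μ]

/-- An integral over two independent variables may be computed by first integrating out one. -/
lemma integral_eq_integral_integral_of_indepFun {Y : Ω → E} {Z : Ω → G} (hY : HasLaw Y μ P)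
    (hZ : AEMeasurable Z P) (h : IndepFun Y Z P) {F : E → G → ℝ}
    (hF : Measurable (Function.uncurry F)) {C : ℝ} (hC : ∀ x z, |F x z| ≤ C) :
    ∫ ω, F (Y ω) (Z ω) ∂P = ∫ ω, ∫ x, F x (Z ω) ∂μ ∂P := by
  have : IsProbabilityMeasure (P.map Z) := Measure.isProbabilityMeasure_map hZ
  have hlaw : P.map (fun ω => (Y ω, Z ω)) = μ.prod (P.map Z) :=
    ((indepFun_iff_hasLaw_prodMk_prod hY ⟨hZ, rfl⟩).1 h).map_eq
  calc ∫ ω, F (Y ω) (Z ω) ∂P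
      = ∫ p, Function.uncurry F p ∂(P.map fun ω => (Y ω, Z ω)) := by
        rw [integral_map (hY.aemeasurable.prodMk hZ) hF.aestronglyMeasurable]; rfl
    _ = ∫ z, ∫ x, F x z ∂μ ∂(P.map Z) := by
        rw [hlaw, integral_prod_symm]
        · rfl
        · exact Integrable.of_bound hF.aestronglyMeasurable C (ae_of_all _ fun p => hC p.1 p.2)
    _ = ∫ ω, ∫ x, F x (Z ω) ∂μ ∂P := by
        rw [integral_map hZ]
        exact (hF.stronglyMeasurable.integral_prod_left' (μ := μ)).aestronglyMeasurable

variable (μ) in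
/-- The completely degenerate part of a kernel in the Hoeffding decomposition. -/
noncomputable def degeneratePart (a : E → E → ℝ) (x y : E) : ℝ :=
  a x y - ∫ z, a x z ∂μ - ∫ z, a z y ∂μ + ∫ z, ∫ w, a z w ∂μ ∂μ

variable {a : E → E → ℝ}

lemma measurable_integral_left (ha : Measurable (Function.uncurry a)) :
    Measurable fun x => ∫ z, a x z ∂μ :=
  ha.stronglyMeasurable.integral_prod_right.measurable

lemma measurable_integral_right (ha : Measurable (Function.uncurry a)) :
    Measurable fun y => ∫ z, a z y ∂μ :=
  (ha.stronglyMeasurable.integral_prod_left' (μ := μ)).measurable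

lemma abs_integral_le_of_abs_le {f : E → ℝ} {C : ℝ} (hf : ∀ x, |f x| ≤ C) :
    |∫ x, f x ∂μ| ≤ C := by
  simpa using norm_integral_le_of_norm_le_const (μ := μ) (f := f) (C := C) (ae_of_all _ hf)

lemma measurable_degeneratePart (ha : Measurable (Function.uncurry a)) :
    Measurable (Function.uncurry (degeneratePart μ a)) :=
  ((ha.sub ((measurable_integral_left ha).comp measurable_fst)).sub
    ((measurable_integral_right ha).comp measurable_snd)).add_const _

lemma abs_degeneratePart_le {C : ℝ} (hC : ∀ x y, |a x y| ≤ C) (x y : E) :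
    |degeneratePart μ a x y| ≤ 4 * C := by
  have h1 := hC x y
  have h2 := abs_integral_le_of_abs_le (μ := μ) (hC x)
  have h3 := abs_integral_le_of_abs_le (μ := μ) (fun z => hC z y)
  have h4 := abs_integral_le_of_abs_le (μ := μ) (fun z => abs_integral_le_of_abs_le (μ := μ) (hC z))
  unfold degeneratePart
  rw [abs_le] at *
  constructor <;> linarith [h1.1, h2.1, h3.1, h4.1, h1.2, h2.2, h3.2, h4.2]

lemma integral_degeneratePart_right (ha : Measurable (Function.uncurry a)) {C : ℝ}
    (hC : ∀ x y, |a x y| ≤ C) (x : E) : ∫ y, degeneratePart μ a x y ∂μ = 0 := by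
  have i1 : Integrable (fun y => a x y) μ :=
    Integrable.of_bound (ha.comp measurable_prodMk_left).aestronglyMeasurable C
      (ae_of_all _ (hC x))
  have i2 : Integrable (fun y => ∫ z, a z y ∂μ) μ :=
    Integrable.of_bound (measurable_integral_right ha).aestronglyMeasurable C
      (ae_of_all _ fun y => abs_integral_le_of_abs_le (fun z => hC z y))
  -- Integrating out the second variable produces the grand mean in the opposite order of
  -- integration to the one in `degeneratePart`.
  have hsymm : ∫ y, ∫ z, a z y ∂μ ∂μ = ∫ z, ∫ w, a z w ∂μ ∂μ :=
    integral_integral_swap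
      (Integrable.of_bound (ha.comp measurable_swap).aestronglyMeasurable C
        (ae_of_all _ fun p => hC p.2 p.1))
  unfold degeneratePart
  have i3 : Integrable (fun y => a x y - ∫ z, a x z ∂μ) μ := i1.sub (integrable_const _)
  have i4 : Integrable (fun y => a x y - ∫ z, a x z ∂μ - ∫ z, a z y ∂μ) μ := i3.sub i2
  rw [integral_add i4 (integrable_const _), integral_sub i3 i2,
    integral_sub i1 (integrable_const _), hsymm]
  simp

lemma integral_degeneratePart_left (ha : Measurable (Function.uncurry a)) {C : ℝ}
    (hC : ∀ x y, |a x y| ≤ C) (y : E) : ∫ x, degeneratePart μ a x y ∂μ = 0 := by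
  have i1 : Integrable (fun x => a x y) μ :=
    Integrable.of_bound (ha.comp measurable_prodMk_right).aestronglyMeasurable C
      (ae_of_all _ fun x => hC x y)
  have i2 : Integrable (fun x => ∫ z, a x z ∂μ) μ :=
    Integrable.of_bound (measurable_integral_left ha).aestronglyMeasurable C
      (ae_of_all _ fun x => abs_integral_le_of_abs_le (hC x))
  unfold degeneratePart
  have i3 : Integrable (fun x => a x y - ∫ z, a x z ∂μ) μ := i1.sub i2
  have i4 : Integrable (fun x => a x y - ∫ z, a x z ∂μ - ∫ z, a z y ∂μ) μ :=
    i3.sub (integrable_const _)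
  rw [integral_add i4 (integrable_const _),
    integral_sub i3 (integrable_const _), integral_sub i1 i2]
  simp

/-- Products of a completely degenerate kernel at pairs with an unshared first index are
uncorrelated. -/
lemma integral_mul_eq_zero_of_ne {k : E → E → ℝ} (hk : Measurable (Function.uncurry k)) {C : ℝ}
    (hC : ∀ x y, |k x y| ≤ C) (h0 : ∀ y, ∫ x, k x y ∂μ = 0) (hlaw : ∀ i, HasLaw (X i) μ P)
    (hX : iIndepFun X P) {i j l m : ι} (hj : i ≠ j) (hl : i ≠ l) (hm : i ≠ m) :
    ∫ ω, k (X i ω) (X j ω) * k (X l ω) (X m ω) ∂P = 0 := by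
  have hmeas := fun i => (hlaw i).aemeasurable
  have h := integral_eq_integral_integral_of_indepFun (hlaw i)
    ((hmeas j).prodMk ((hmeas l).prodMk (hmeas m)))
    (indepFun_of_iIndepFun_of_ne hlaw hX hj hl hm)
    (F := fun x z => k x z.1 * k z.2.1 z.2.2) (C := C * C)
    ((hk.comp (measurable_fst.prodMk measurable_snd.fst)).mul
      (hk.comp measurable_snd.snd))
    (fun x z => by
      rw [abs_mul]
      exact mul_le_mul (hC _ _) (hC _ _) (abs_nonneg _) ((abs_nonneg _).trans (hC x x)))
  rw [h]
  simp [integral_mul_const, h0]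

/-- The second moment of the sum of a completely degenerate kernel over pairs of distinct indices
grows at most quadratically. -/
lemma integral_sq_sum_offDiag_le {k : E → E → ℝ} (hk : Measurable (Function.uncurry k)) {C : ℝ}
    (hC : ∀ x y, |k x y| ≤ C) (hl : ∀ y, ∫ x, k x y ∂μ = 0) (hr : ∀ x, ∫ y, k x y ∂μ = 0)
    (hlaw : ∀ i, HasLaw (X i) μ P) (hX : iIndepFun X P) [DecidableEq ι] (s : Finset ι) :
    ∫ ω, (∑ p ∈ s.offDiag, k (X p.1 ω) (X p.2 ω)) ^ 2 ∂P ≤ s.offDiag.card * (2 * C ^ 2) := by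
  have hmeas := fun i => (hlaw i).aemeasurable
  have hb (p q : ι × ι) (ω : Ω) :
      |k (X p.1 ω) (X p.2 ω) * k (X q.1 ω) (X q.2 ω)| ≤ C ^ 2 := by
    rw [abs_mul, sq]
    exact mul_le_mul (hC _ _) (hC _ _) (abs_nonneg _)
      ((abs_nonneg _).trans (hC (X p.1 ω) (X p.1 ω)))
  have hkm (p : ι × ι) : AEMeasurable (fun ω => k (X p.1 ω) (X p.2 ω)) P :=
    hk.comp_aemeasurable ((hmeas p.1).prodMk (hmeas p.2))
  have hint (p q : ι × ι) :
      Integrable (fun ω => k (X p.1 ω) (X p.2 ω) * k (X q.1 ω) (X q.2 ω)) P :=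
    Integrable.of_bound ((hkm p).mul (hkm q)).aestronglyMeasurable (C ^ 2)
      (ae_of_all _ (hb p q))
  have hz (p q : ι × ι) (hp : p ∈ s.offDiag) (hq : q ∈ s.offDiag)
      (hpq : q ∉ ({p, p.swap} : Finset (ι × ι))) :
      ∫ ω, k (X p.1 ω) (X p.2 ω) * k (X q.1 ω) (X q.2 ω) ∂P = 0 := by
    obtain ⟨i, j⟩ := p
    obtain ⟨l, m⟩ := q
    simp only [Finset.mem_offDiag, Finset.mem_insert, Finset.mem_singleton, Prod.mk.injEq,
      Prod.swap_prod_mk] at hp hq hpq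
    by_cases h1 : i ≠ l ∧ i ≠ m
    · exact integral_mul_eq_zero_of_ne hk hC hl hlaw hX hp.2.2 h1.1 h1.2
    -- Here `i` belongs to `{l, m}`; since `q` is neither `p` nor its swap, `j` does not. So `j` is
    -- the unshared index, and the transposed kernel puts it in first position.
    · have h2 : j ≠ l ∧ j ≠ m := by grind
      exact integral_mul_eq_zero_of_ne (k := fun x y => k y x) (hk.comp measurable_swap)
        (fun x y => hC y x) hr hlaw hX hp.2.2.symm h2.2 h2.1
  simp_rw [sq (Finset.sum _ _), Finset.sum_mul_sum]
  rw [integral_finsetSum _ fun p _ => integrable_finsetSum _ fun q _ => hint p q]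
  rw [← nsmul_eq_mul]
  refine Finset.sum_le_card_nsmul _ _ _ fun p hp => ?_
  rw [integral_finsetSum _ fun q _ => hint p q]
  -- For fixed `p` only `q = p` and `q = p.swap` can contribute, each at most `C ^ 2`.
  calc ∑ q ∈ s.offDiag, ∫ ω, k (X p.1 ω) (X p.2 ω) * k (X q.1 ω) (X q.2 ω) ∂P
      ≤ ∑ q ∈ s.offDiag, if q ∈ ({p, p.swap} : Finset (ι × ι)) then C ^ 2 else 0 := by
        refine Finset.sum_le_sum fun q hq => ?_
        split_ifs with h
        · exact (le_abs_self _).trans (abs_integral_le_of_abs_le (hb p q))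
        · exact (hz p q hp hq h).le
    _ = (s.offDiag.filter (· ∈ ({p, p.swap} : Finset (ι × ι)))).card * C ^ 2 := by
        rw [← Finset.sum_filter, Finset.sum_const, nsmul_eq_mul]
    _ ≤ 2 * C ^ 2 := by
        refine mul_le_mul_of_nonneg_right ?_ (sq_nonneg C)
        have : (s.offDiag.filter (· ∈ ({p, p.swap} : Finset (ι × ι)))).card ≤ 2 :=
          (Finset.card_le_card (fun q hq => (Finset.mem_filter.1 hq).2)).trans Finset.card_le_two
        exact_mod_cast this

/-- Each index is paired with the `s.card - 1` others: the full product sum minus the diagonal. -/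
lemma sum_offDiag_fst [DecidableEq ι] (s : Finset ι) (f : ι → ℝ) :
    ∑ p ∈ s.offDiag, f p.1 = (s.card - 1) * ∑ i ∈ s, f i := by
  have h := Finset.sum_union (Finset.disjoint_diag_offDiag s) (f := fun p : ι × ι => f p.1)
  rw [Finset.diag_union_offDiag, Finset.sum_product, Finset.sum_diag] at h
  simp only [Finset.sum_const, nsmul_eq_mul, ← Finset.mul_sum] at h
  linarith

lemma sum_offDiag_snd [DecidableEq ι] (s : Finset ι) (f : ι → ℝ) :
    ∑ p ∈ s.offDiag, f p.2 = (s.card - 1) * ∑ i ∈ s, f i := by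
  have h := Finset.sum_union (Finset.disjoint_diag_offDiag s) (f := fun p : ι × ι => f p.2)
  rw [Finset.diag_union_offDiag, Finset.sum_product, Finset.sum_diag] at h
  simp only [Finset.sum_const, nsmul_eq_mul] at h
  linarith

end UStatistic

/-! ### Central limit theorem for U-statistics -/

section UStatisticCLT

open scoped Topology

variable {E Ω : Type*} [MeasurableSpace E] [MeasurableSpace Ω]

/-- Markov's inequality applied to the squares. -/
lemma tendstoInMeasure_zero_of_integral_sq {P : Measure Ω} [IsFiniteMeasure P]
    {Y : ℕ → Ω → ℝ} (hint : ∀ n, Integrable (fun ω => Y n ω ^ 2) P)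
    (h : Tendsto (fun n => ∫ ω, Y n ω ^ 2 ∂P) atTop (𝓝 0)) : TendstoInMeasure P Y atTop 0 := by
  rw [tendstoInMeasure_iff_measureReal_norm]
  intro ε hε
  refine squeeze_zero (fun _ => measureReal_nonneg) (fun n => ?_)
    (by simpa using h.const_mul ((ε ^ 2)⁻¹))
  have hM := mul_meas_ge_le_integral_of_nonneg (ae_of_all P fun ω => sq_nonneg (Y n ω)) (hint n)
    (ε ^ 2)
  have hset : {ω | ε ≤ ‖Y n ω - (0 : Ω → ℝ) ω‖} = {ω | ε ^ 2 ≤ Y n ω ^ 2} := by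
    ext ω
    simp only [Pi.zero_apply, sub_zero, Real.norm_eq_abs, mem_ofPred_eq]
    rw [← sq_abs (Y n ω), sq_le_sq₀ hε.le (abs_nonneg _)]
  rw [hset, le_inv_mul_iff₀ (by positivity)]
  exact hM

/-- The U-statistic of order two with kernel `a`: the average of `a` over ordered pairs of distinct
sample points. -/
noncomputable def pairAverage (a : E → E → ℝ) {n : ℕ} (x : Fin n → E) : ℝ :=
  (∑ p ∈ (Finset.univ : Finset (Fin n)).offDiag, a (x p.1) (x p.2)) / (n * (n - 1))

lemma measurable_pairAverage {a : E → E → ℝ} (ha : Measurable (Function.uncurry a)) (n : ℕ) :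
    Measurable (pairAverage a : (Fin n → E) → ℝ) := by
  unfold pairAverage
  refine (Finset.measurable_sum _ fun p _ => ?_).div_const _
  exact ha.comp (f := fun x : Fin n → E => (x p.1, x p.2))
    ((measurable_pi_apply p.1).prodMk (measurable_pi_apply p.2))

variable {P : Measure Ω} {μ : Measure E} {a : E → E → ℝ}

lemma cast_card_offDiag_fin {n : ℕ} (hn : 1 ≤ n) :
    ((Finset.univ : Finset (Fin n)).offDiag.card : ℝ) = n * (n - 1) := by
  rw [Finset.offDiag_card, Finset.card_fin, ← Nat.mul_sub_one]
  push_cast [hn]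
  rfl

/-- The Hoeffding decomposition of a U-statistic of order two. -/
lemma pairAverage_sub_eq {n : ℕ} (hn : 2 ≤ n) (x : Fin n → E) :
    pairAverage a x - ∫ z, ∫ w, a z w ∂μ ∂μ =
      (n : ℝ)⁻¹ * (∑ i, (∫ z, a (x i) z ∂μ + ∫ z, a z (x i) ∂μ) -
        n * (2 * ∫ z, ∫ w, a z w ∂μ ∂μ)) + pairAverage (degeneratePart μ a) x := by
  have hn' : (2 : ℝ) ≤ n := by exact_mod_cast hn
  have h0 : (n : ℝ) ≠ 0 := by linarith
  have h1 : (n : ℝ) - 1 ≠ 0 := by linarith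
  unfold pairAverage degeneratePart
  simp only [Finset.sum_add_distrib, Finset.sum_sub_distrib, Finset.sum_const, nsmul_eq_mul]
  rw [cast_card_offDiag_fin (by omega), sum_offDiag_fst _ (fun i => ∫ z, a (x i) z ∂μ),
    sum_offDiag_snd _ (fun i => ∫ z, a z (x i) ∂μ)]
  simp only [Finset.card_univ, Fintype.card_fin]
  field_simp
  ring

variable [IsProbabilityMeasure P] [IsProbabilityMeasure μ]

/-- The degenerate part of a U-statistic is negligible at the scale of the central limit theorem. -/
lemma tendsto_integral_sq_pairAverage_degeneratePart (ha : Measurable (Function.uncurry a)) {C : ℝ}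
    (hC : ∀ x y, |a x y| ≤ C) {Y : ℕ → Ω → E} (hlaw : ∀ i, HasLaw (Y i) μ P)
    (hY : iIndepFun Y P) :
    Tendsto (fun n : ℕ => ∫ ω, (√(n : ℝ) *
      pairAverage (degeneratePart μ a) (fun i : Fin n => Y i ω)) ^ 2 ∂P) atTop (𝓝 0) := by
  -- The degenerate kernel is bounded by `4 * C`, so its sum has second moment at most `n(n-1) ·
  -- 2(4C)²`; multiplying by `n / (n(n-1))²` leaves `32C²/(n-1)`.
  have hlim : Tendsto (fun n : ℕ => (32 * C ^ 2) / ((n : ℝ) - 1)) atTop (𝓝 0) :=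
    (tendsto_natCast_atTop_atTop.atTop_add tendsto_const_nhds).const_div_atTop _
  refine squeeze_zero' (Eventually.of_forall fun n => integral_nonneg fun ω => sq_nonneg _) ?_ hlim
  filter_upwards [eventually_ge_atTop 2] with n hn
  have hn' : (2 : ℝ) ≤ n := by exact_mod_cast hn
  have h1 : (0 : ℝ) < (n : ℝ) - 1 := by linarith
  have hK := integral_sq_sum_offDiag_le (measurable_degeneratePart ha) (abs_degeneratePart_le hC)
    (integral_degeneratePart_left ha hC) (integral_degeneratePart_right ha hC)
    (fun i : Fin n => hlaw i) (hY.precomp Fin.val_injective) Finset.univ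
  rw [cast_card_offDiag_fin (by omega)] at hK
  have heq (ω : Ω) : (√(n : ℝ) * pairAverage (degeneratePart μ a) (fun i : Fin n => Y i ω)) ^ 2 =
      ((n : ℝ) * (n - 1) ^ 2)⁻¹ * (∑ p ∈ (Finset.univ : Finset (Fin n)).offDiag,
        degeneratePart μ a (Y p.1 ω) (Y p.2 ω)) ^ 2 := by
    unfold pairAverage
    rw [mul_pow, Real.sq_sqrt (by positivity)]
    field_simp
  simp_rw [heq]
  rw [integral_const_mul]
  calc _ ≤ ((n : ℝ) * (n - 1) ^ 2)⁻¹ * (n * (n - 1) * (2 * (4 * C) ^ 2)) := by gcongr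
    _ = _ := by field_simp; ring

/-- **Central limit theorem for U-statistics** of order two with bounded kernel, for an
independent and identically distributed sequence. -/
lemma tendstoInDistribution_sqrt_mul_pairAverage_sub (ha : Measurable (Function.uncurry a)) {C : ℝ}
    (hC : ∀ x y, |a x y| ≤ C) {Y : ℕ → Ω → E} (hlaw : ∀ i, HasLaw (Y i) μ P)
    (hY : iIndepFun Y P) {v : ℝ} (hv : Var[fun x => ∫ z, a x z ∂μ + ∫ z, a z x ∂μ; μ] = v) :
    TendstoInDistribution (fun (n : ℕ) ω => √(n : ℝ) *
      (pairAverage a (fun i : Fin n => Y i ω) - ∫ z, ∫ w, a z w ∂μ ∂μ)) atTop (id : ℝ → ℝ)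
      (fun _ => P) (gaussianReal 0 v.toNNReal) := by
  set φ : E → ℝ := fun x => ∫ z, a x z ∂μ + ∫ z, a z x ∂μ with hφ
  have hφm : Measurable φ := (measurable_integral_left ha).add (measurable_integral_right ha)
  have hφb (x : E) : ‖φ x‖ ≤ C + C :=
    (norm_add_le _ _).trans (add_le_add (abs_integral_le_of_abs_le (hC x))
      (abs_integral_le_of_abs_le fun z => hC z x))
  have hmeas := fun i => (hlaw i).aemeasurable
  have hident (i : ℕ) : IdentDistrib (φ ∘ Y i) (φ ∘ Y 0) P P :=
    (IdentDistrib.mk (hmeas i) (hmeas 0) ((hlaw i).map_eq.trans (hlaw 0).map_eq.symm)).comp hφm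
  have hmean : P[φ ∘ Y 0] = 2 * ∫ z, ∫ w, a z w ∂μ ∂μ := by
    rw [(hlaw 0).integral_comp hφm.aestronglyMeasurable, hφ, integral_add
      (Integrable.of_bound (measurable_integral_left ha).aestronglyMeasurable C
        (ae_of_all _ fun x => abs_integral_le_of_abs_le (hC x)))
      (Integrable.of_bound (measurable_integral_right ha).aestronglyMeasurable C
        (ae_of_all _ fun y => abs_integral_le_of_abs_le (fun z => hC z y)))]
    rw [integral_integral_swap (f := fun x z => a z x)
      (Integrable.of_bound (ha.comp measurable_swap).aestronglyMeasurable C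
        (ae_of_all _ fun p => hC p.2 p.1))]
    ring
  have hvar : Var[φ ∘ Y 0; P] = v := by
    rw [← hv, ← (hlaw 0).map_eq, variance_map hφm.aemeasurable (hmeas 0)]
  have hclt := tendstoInDistribution_inv_sqrt_mul_sum_sub (X := fun i => φ ∘ Y i) (P := P)
    (Y := (id : ℝ → ℝ)) (P' := gaussianReal 0 v.toNNReal) (by rw [hvar]; exact HasLaw.id)
    (MemLp.of_bound (hφm.comp_aemeasurable (hmeas 0)).aestronglyMeasurable (C + C)
      (ae_of_all _ fun ω => hφb _))
    (hY.comp (fun _ => φ) fun _ => hφm) hident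
  have hpair {k : E → E → ℝ} (hk : Measurable (Function.uncurry k)) (n : ℕ) :
      AEMeasurable (fun ω => pairAverage k (fun i : Fin n => Y i ω)) P :=
    (measurable_pairAverage hk n).comp_aemeasurable (aemeasurable_pi_lambda _ fun i => hmeas i)
  -- Slutsky: it remains to show that the difference from the normalised sum of `φ (Y i)` tends to
  -- `0` in measure. For `n ≥ 2` this difference is exactly the scaled degenerate part.
  refine tendstoInDistribution_of_tendstoInMeasure_sub _ _ hclt ?_
    fun n => ((hpair ha n).sub_const _).const_mul _
  have hdeg : TendstoInMeasure P (fun (n : ℕ) ω => √(n : ℝ) *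
      pairAverage (degeneratePart μ a) (fun i : Fin n => Y i ω)) atTop 0 := by
    refine tendstoInMeasure_zero_of_integral_sq (fun n => ?_)
      (tendsto_integral_sq_pairAverage_degeneratePart ha hC hlaw hY)
    refine MemLp.integrable_sq (MemLp.const_mul (MemLp.of_bound
      (hpair (measurable_degeneratePart ha) n).aestronglyMeasurable
      ((∑ p ∈ (Finset.univ : Finset (Fin n)).offDiag, 4 * C) / |(n : ℝ) * (n - 1)|)
      (ae_of_all _ fun ω => ?_)) _)
    rw [pairAverage, norm_div, Real.norm_eq_abs, Real.norm_eq_abs]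
    gcongr
    exact (Finset.abs_sum_le_sum_abs _ _).trans
      (Finset.sum_le_sum fun p _ => abs_degeneratePart_le hC _ _)
  refine hdeg.congr' ?_ (ae_eq_refl _)
  filter_upwards [eventually_ge_atTop 2] with n hn
  refine ae_of_all _ fun ω => ?_
  have hn' : (0 : ℝ) < n := by exact_mod_cast (by omega : 0 < n)
  have hs : √(n : ℝ) * (n : ℝ)⁻¹ = (√(n : ℝ))⁻¹ := by
    rw [← div_eq_mul_inv, Real.sqrt_div_self']; simp
  simp only [Pi.sub_apply, Function.comp_apply]
  change ∫ ω, φ (Y 0 ω) ∂P = _ at hmean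
  rw [pairAverage_sub_eq hn, mul_add, ← mul_assoc, hs, hmean, Finset.sum_range]
  ring

/-- **Central limit theorem for U-statistics** of order two with bounded kernel, for a triangular
array whose rows are independent and identically distributed. -/
theorem tendstoInDistribution_sqrt_mul_pairAverage_sub_of_array
    (ha : Measurable (Function.uncurry a)) {C : ℝ} (hC : ∀ x y, |a x y| ≤ C)
    {Ω : ℕ → Type*} [∀ n, MeasurableSpace (Ω n)] (P : (n : ℕ) → Measure (Ω n))
    [∀ n, IsProbabilityMeasure (P n)] (X : (n : ℕ) → Fin n → Ω n → E)
    (hlaw : ∀ n i, HasLaw (X n i) μ (P n)) (hindep : ∀ n, iIndepFun (X n) (P n)) {v : ℝ}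
    (hv : Var[fun x => ∫ z, a x z ∂μ + ∫ z, a z x ∂μ; μ] = v) :
    TendstoInDistribution (fun (n : ℕ) (ω : Ω n) => √(n : ℝ) *
      (pairAverage a (fun i => X n i ω) - ∫ z, ∫ w, a z w ∂μ ∂μ)) atTop (id : ℝ → ℝ)
      P (gaussianReal 0 v.toNNReal) := by
  -- Convergence in distribution sees only the law of each row, which is a product of copies of `μ`.
  -- Each row may thus be replaced by an initial segment of one i.i.d. sequence.
  obtain ⟨Ω', _, P', Y, -, hYlaw, hY, _⟩ := exists_iid ℕ μ
  have h := tendstoInDistribution_sqrt_mul_pairAverage_sub ha hC hYlaw hY hv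
  let F (n : ℕ) (x : Fin n → E) : ℝ := √(n : ℝ) * (pairAverage a x - ∫ z, ∫ w, a z w ∂μ ∂μ)
  have hF (n : ℕ) : Measurable (F n) := ((measurable_pairAverage ha n).sub_const _).const_mul _
  have hXn (n : ℕ) := (hindep n).hasLaw_pi (hlaw n)
  have hYn (n : ℕ) := iIndepFun.hasLaw_pi (X := fun (i : Fin n) => Y i)
    (fun i => hYlaw i) (hY.precomp Fin.val_injective)
  refine ⟨fun n => (hF n).comp_aemeasurable (hXn n).aemeasurable, aemeasurable_id, ?_⟩
  refine h.tendsto.congr fun n => Subtype.ext ?_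
  have h1 := AEMeasurable.map_map_of_aemeasurable (hF n).aemeasurable (hXn n).aemeasurable
  have h2 := AEMeasurable.map_map_of_aemeasurable (hF n).aemeasurable (hYn n).aemeasurable
  rw [(hXn n).map_eq] at h1
  rw [(hYn n).map_eq] at h2
  exact h2.symm.trans h1

end UStatisticCLT

/-! ### Covariance of a kernel at overlapping pairs -/

section KernelCovariance

variable {E : Type*} [MeasurableSpace E] {μ : Measure E} [IsProbabilityMeasure μ]

/-- The covariance of a kernel evaluated at two pairs sharing one sample point is the variance of
its first projection. -/
lemma covariance_pi_eq_variance_integral {h : E → E → ℝ} (hm : Measurable (Function.uncurry h))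
    {C : ℝ} (hC : ∀ x y, |h x y| ≤ C) :
    covariance (fun x : Fin 3 → E => h (x 0) (x 1)) (fun x : Fin 3 → E => h (x 0) (x 2))
      (Measure.pi fun _ : Fin 3 => μ) = Var[fun x => ∫ z, h x z ∂μ; μ] := by
  set Q : Measure (Fin 3 → E) := Measure.pi fun _ => μ
  have hlaw (i : Fin 3) : HasLaw (fun x : Fin 3 → E => x i) μ Q :=
    (measurePreserving_eval (fun _ : Fin 3 => μ) i).hasLaw
  have hind : iIndepFun (fun (i : Fin 3) (x : Fin 3 → E) => x i) Q :=
    iIndepFun_pi (X := fun _ => id) fun _ => aemeasurable_id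
  have hmem (i : Fin 3) : MemLp (fun x : Fin 3 → E => h (x 0) (x i)) 2 Q :=
    MemLp.of_bound (hm.comp (f := fun x : Fin 3 → E => (x 0, x i))
      (by fun_prop)).aestronglyMeasurable C (ae_of_all _ fun x => hC _ _)
  have hHm : Measurable fun x => ∫ z, h x z ∂μ := measurable_integral_left hm
  have hHb := fun x => abs_integral_le_of_abs_le (μ := μ) (hC x)
  have hmul {u v : ℝ} (hu : |u| ≤ C) (hv : |v| ≤ C) : |u * v| ≤ C * C := by
    rw [abs_mul]
    exact mul_le_mul hu hv (abs_nonneg _) ((abs_nonneg _).trans hu)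
  have hmean (i : Fin 3) (hi : i ≠ 0) : Q[fun x => h (x 0) (x i)] = ∫ x, ∫ z, h x z ∂μ ∂μ := by
    rw [integral_eq_integral_integral_of_indepFun (hlaw i) (hlaw 0).aemeasurable
      (hind.indepFun hi) (F := fun x z => h z x) (hm.comp measurable_swap) fun x z => hC z x]
    exact (hlaw 0).integral_comp hHm.aestronglyMeasurable
  have hprod : Q[fun x => h (x 0) (x 1) * h (x 0) (x 2)] = ∫ x, (∫ z, h x z ∂μ) ^ 2 ∂μ := by
    have hZ (j k l : Fin 3) : AEMeasurable (fun x : Fin 3 → E => (x j, x k, x l)) Q := by fun_prop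
    -- Coordinate 1 is integrated out first, then coordinate 2, each leaving a factor `∫ z, h (x 0)
    -- z`. Index `0` is repeated only to fill the triple in the independence lemma.
    rw [integral_eq_integral_integral_of_indepFun (hlaw 1) (hZ 0 0 2)
      (indepFun_of_iIndepFun_of_ne hlaw hind (by decide) (by decide) (by decide))
      (F := fun y z => h z.1 y * h z.2.1 z.2.2) (C := C * C)
      ((hm.comp (f := fun p : E × E × E × E => (p.2.1, p.1)) (by fun_prop)).mul
        (hm.comp (f := fun p : E × E × E × E => (p.2.2.1, p.2.2.2)) (by fun_prop)))
      (fun y z => hmul (hC _ _) (hC _ _))]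
    simp only [integral_mul_const]
    rw [integral_eq_integral_integral_of_indepFun (hlaw 2) (hlaw 0).aemeasurable
      (hind.indepFun (by decide)) (F := fun y z => (∫ w, h z w ∂μ) * h z y) (C := C * C)
      ((hHm.comp measurable_snd).mul (hm.comp measurable_swap))
      (fun y z => hmul (hHb _) (hC _ _))]
    simp only [integral_const_mul, ← sq]
    exact (hlaw 0).integral_comp (hHm.pow_const 2).aestronglyMeasurable
  rw [covariance_eq_sub (hmem 1) (hmem 2), hmean 1 (by decide), hmean 2 (by decide),
    variance_eq_sub (MemLp.of_bound hHm.aestronglyMeasurable C (ae_of_all _ hHb)), ← sq]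
  exact congrArg (· - _) hprod

end KernelCovariance

/-! ### Integrals of the tent function and of the projection -/

section PiecewiseIntegrals

lemma integral_quadratic (A B D a b : ℝ) :
    ∫ t in a..b, (A + B * t + D * t ^ 2) =
      A * (b - a) + B * (b ^ 2 - a ^ 2) / 2 + D * (b ^ 3 - a ^ 3) / 3 := by
  rw [intervalIntegral.integral_add, intervalIntegral.integral_add]
  · rw [intervalIntegral.integral_const_mul B, integral_id]
    simp; ring
  all_goals exact Continuous.intervalIntegrable (by fun_prop) _ _

/-- Splits at the breakpoint. Agreement on both closed pieces is available below because the two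
branches of `tent` agree at the peak. -/
lemma integral_eq_add_of_eqOn {f p q : ℝ → ℝ} {a b c : ℝ} (hab : a ≤ b) (hbc : b ≤ c)
    (hp : Continuous p) (hq : Continuous q) (hfp : EqOn f p (Icc a b)) (hfq : EqOn f q (Icc b c)) :
    ∫ t in a..c, f t = (∫ t in a..b, p t) + ∫ t in b..c, q t := by
  rw [← uIcc_of_le hab] at hfp
  rw [← uIcc_of_le hbc] at hfq
  rw [← intervalIntegral.integral_add_adjacent_intervals (b := b),
    intervalIntegral.integral_congr hfp, intervalIntegral.integral_congr hfq]
  · exact (hp.intervalIntegrable a b).congr fun x hx => (hfp (uIoc_subset_uIcc hx)).symm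
  · exact (hq.intervalIntegrable b c).congr fun x hx => (hfq (uIoc_subset_uIcc hx)).symm

/-- The tent function on `[0, 1]` with peak value `1` at `c`. -/
noncomputable def tent (c t : ℝ) : ℝ :=
  if t < c then t / c else (1 - t) / (1 - c)

lemma tent_of_le {c t : ℝ} (hc : 0 < c) (hc1 : c < 1) (ht : t ≤ c) : tent c t = t / c := by
  rcases ht.lt_or_eq with h | rfl
  · exact if_pos h
  · rw [tent, if_neg (lt_irrefl _), div_self hc.ne', div_self (by linarith)]

lemma tent_of_ge {c t : ℝ} (ht : c ≤ t) : tent c t = (1 - t) / (1 - c) :=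
  if_neg ht.not_gt

variable {c : ℝ}

lemma integral_tent (hc : 0 < c) (hc1 : c < 1) : ∫ t in (0 : ℝ)..1, tent c t = 1 / 2 := by
  have h1 : (1 : ℝ) - c ≠ 0 := by linarith
  -- The branches are written as `A + B * t + D * t ^ 2`, zero terms included, so that
  -- `integral_quadratic` applies literally.
  rw [integral_eq_add_of_eqOn hc.le hc1.le (p := fun t => 0 + c⁻¹ * t + 0 * t ^ 2)
    (q := fun t => (1 - c)⁻¹ + (-(1 - c)⁻¹) * t + 0 * t ^ 2) (by fun_prop) (by fun_prop)
    (fun t ht => ?_) (fun t ht => ?_), integral_quadratic, integral_quadratic]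
  · field_simp; ring
  · dsimp only; rw [tent_of_le hc hc1 ht.2]; ring
  · dsimp only; rw [tent_of_ge ht.1]; ring

lemma integral_tent_add_linear (hc : 0 < c) (hc1 : c < 1) :
    ∫ t in (0 : ℝ)..1, (tent c t + (1 - c * t - (1 - c) * (1 - t))) = 1 := by
  have h1 : (1 : ℝ) - c ≠ 0 := by linarith
  rw [integral_eq_add_of_eqOn hc.le hc1.le (p := fun t => c + (c⁻¹ + 1 - 2 * c) * t + 0 * t ^ 2)
    (q := fun t => ((1 - c)⁻¹ + c) + (1 - 2 * c - (1 - c)⁻¹) * t + 0 * t ^ 2)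
    (by fun_prop) (by fun_prop)
    (fun t ht => ?_) (fun t ht => ?_), integral_quadratic, integral_quadratic]
  · field_simp; ring
  · dsimp only; rw [tent_of_le hc hc1 ht.2]; ring
  · dsimp only; rw [tent_of_ge ht.1]; ring

lemma integral_tent_add_linear_sq (hc : 0 < c) (hc1 : c < 1) :
    ∫ t in (0 : ℝ)..1, (tent c t + (1 - c * t - (1 - c) * (1 - t))) ^ 2 = 1 + c * (1 - c) / 3 := by
  have h1 : (1 : ℝ) - c ≠ 0 := by linarith
  rw [integral_eq_add_of_eqOn hc.le hc1.le
    (p := fun t => c ^ 2 + (2 * c * (c⁻¹ + 1 - 2 * c)) * t + (c⁻¹ + 1 - 2 * c) ^ 2 * t ^ 2)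
    (q := fun t => ((1 - c)⁻¹ + c) ^ 2 + (2 * ((1 - c)⁻¹ + c) * (1 - 2 * c - (1 - c)⁻¹)) * t +
      (1 - 2 * c - (1 - c)⁻¹) ^ 2 * t ^ 2)
    (by fun_prop) (by fun_prop)
    (fun t ht => ?_) (fun t ht => ?_), integral_quadratic, integral_quadratic]
  · field_simp; ring
  · dsimp only; rw [tent_of_le hc hc1 ht.2]; ring
  · dsimp only; rw [tent_of_ge ht.1]; ring

end PiecewiseIntegrals

/-! ### The uniform law and measurability of arcs -/

namespace CentralSimilarity

section Uniform

variable {y₁ y₂ : ℝ}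

lemma isProbabilityMeasure_uniform (hy : y₁ < y₂) : IsProbabilityMeasure (uniform y₁ y₂) :=
  cond_isProbabilityMeasure_of_finite (by simp [hy]) (by simp)

lemma ae_mem_Ioo_uniform (y₁ y₂ : ℝ) : ∀ᵐ x ∂uniform y₁ y₂, x ∈ Ioo y₁ y₂ :=
  ae_cond_mem measurableSet_Ioo

/-- Affine change of variables to `[0, 1]`, which removes `y₁` and `y₂` from all later computations.
-/
lemma integral_uniform_comp (hy : y₁ < y₂) (f : ℝ → ℝ) :
    ∫ x, f ((x - y₁) / (y₂ - y₁)) ∂uniform y₁ y₂ = ∫ t in (0 : ℝ)..1, f t := by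
  have hd : y₂ - y₁ ≠ 0 := by linarith
  rw [uniform, ProbabilityTheory.cond, integral_smul_measure, Real.volume_Ioo,
    ← integral_Ioc_eq_integral_Ioo, ← intervalIntegral.integral_of_le hy.le,
    intervalIntegral.integral_comp_sub_right (fun x => f (x / (y₂ - y₁))),
    intervalIntegral.integral_comp_div _ hd]
  simp [hd, hy.le]

lemma uniform_real_eq_of_inter_eq {s : Set ℝ} {u v : ℝ} (hy : y₁ < y₂) (huv : u ≤ v)
    (hs : Ioo y₁ y₂ ∩ s = Ioo u v) : (uniform y₁ y₂).real s = (v - u) / (y₂ - y₁) := by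
  rw [uniform, measureReal_def, cond_apply measurableSet_Ioo, hs, Real.volume_Ioo, Real.volume_Ioo,
    ENNReal.toReal_mul, ENNReal.toReal_inv, ENNReal.toReal_ofReal (by linarith),
    ENNReal.toReal_ofReal (by linarith), div_eq_inv_mul]

end Uniform

/-- The indicator of an arc from the first to the second argument. -/
noncomputable def arcKernel (y₁ y₂ τ c a b : ℝ) : ℝ :=
  (proximityRegion y₁ y₂ τ c a).indicator 1 b

lemma measurableSet_mem_ite {α β : Type*} [MeasurableSpace α] {p : α → Prop} [DecidablePred p]
    {f : α → β} {S T : α → Set β} (hp : MeasurableSet {x | p x})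
    (hS : MeasurableSet {x | f x ∈ S x}) (hT : MeasurableSet {x | f x ∈ T x}) :
    MeasurableSet {x | f x ∈ if p x then S x else T x} := by
  convert hp.ite hS hT using 1
  ext x
  by_cases h : p x <;> simp [Set.ite, h]

lemma measurableSet_mem_Ioo_inter {α : Type*} [MeasurableSpace α] {f g h : α → ℝ} {S : Set ℝ}
    (hf : Measurable f) (hg : Measurable g) (hh : Measurable h) (hS : MeasurableSet S) :
    MeasurableSet {x | f x ∈ Ioo (g x) (h x) ∩ S} :=
  ((measurableSet_lt hg hf).inter (measurableSet_lt hf hh)).inter (hf hS)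

lemma measurableSet_arc (y₁ y₂ τ c : ℝ) :
    MeasurableSet {p : ℝ × ℝ | p.2 ∈ proximityRegion y₁ y₂ τ c p.1} := by
  unfold proximityRegion
  refine measurableSet_mem_ite (measurableSet_lt (by fun_prop) (by fun_prop))
    (measurableSet_mem_Ioo_inter (by fun_prop) (by fun_prop) (by fun_prop) measurableSet_Iio) <|
    measurableSet_mem_ite (measurableSet_lt (by fun_prop) (by fun_prop))
    (measurableSet_mem_Ioo_inter (by fun_prop) (by fun_prop) (by fun_prop) measurableSet_Ioi) <|
    measurableSet_mem_ite ((measurableSet_eq_fun (by fun_prop) (by fun_prop)).union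
      (measurableSet_eq_fun (by fun_prop) (by fun_prop)))
    (measurableSet_eq_fun (by fun_prop) (by fun_prop)) <|
    measurableSet_mem_ite (measurableSet_lt (by fun_prop) (by fun_prop))
    (measurableSet_mem_Ioo_inter (by fun_prop) (by fun_prop) (by fun_prop) measurableSet_Ioo)
    (measurableSet_mem_Ioo_inter (by fun_prop) (by fun_prop) (by fun_prop) measurableSet_Ioo)

variable {y₁ y₂ τ c : ℝ}

lemma measurable_arcKernel :
    Measurable (Function.uncurry (arcKernel y₁ y₂ τ c)) :=
  (measurable_const (a := (1 : ℝ))).indicator (measurableSet_arc y₁ y₂ τ c)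

lemma abs_arcKernel_le (a b : ℝ) : |arcKernel y₁ y₂ τ c a b| ≤ 1 := by
  unfold arcKernel indicator
  split_ifs <;> simp

/-! ### Outgoing and incoming arc probabilities for `τ = 1` -/

/-- For `τ = 1` the region of `a` extends to `y₁` when `a` is left of the centre and to `y₂`
otherwise, so only the other end is a constraint. Cleared of denominators, that constraint is linear
in both points and can be solved for either one. -/
lemma mem_proximityRegion_iff (hc : c ∈ Ioo (0 : ℝ) 1) {a b : ℝ} (ha : a ∈ Ioo y₁ y₂)
    (hb : b ∈ Ioo y₁ y₂) :
    b ∈ proximityRegion y₁ y₂ 1 c a ↔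
      if a < y₁ + c * (y₂ - y₁) then c * (b - y₁) < a - y₁ else (1 - c) * (y₂ - b) < y₂ - a := by
  have hc1 : 0 < 1 - c := by linarith [hc.2]
  rw [proximityRegion, if_neg ha.1.not_gt, if_neg ha.2.not_gt,
    if_neg (by rintro (rfl | rfl); exacts [lt_irrefl _ ha.1, lt_irrefl _ ha.2])]
  split_ifs with h
  · have e : a + 1 * (1 - c) * (a - y₁) / c = y₁ + (a - y₁) / c := by
      have := hc.1.ne'
      field_simp; ring
    rw [e, mem_inter_iff, mem_Ioo, and_iff_left hb, and_iff_right (by linarith [hb.1]),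
      ← sub_lt_iff_lt_add', lt_div_iff₀' hc.1]
  · have e : a - c * 1 * (y₂ - a) / (1 - c) = y₂ - (y₂ - a) / (1 - c) := by
      field_simp; ring
    rw [e, mem_inter_iff, mem_Ioo, and_iff_left hb, and_iff_left (by linarith [hb.2]),
      sub_lt_comm, lt_div_iff₀' hc1]

lemma integral_arcKernel_left (hy : y₁ < y₂) (hc : c ∈ Ioo (0 : ℝ) 1) {x : ℝ}
    (hx : x ∈ Ioo y₁ y₂) :
    ∫ z, arcKernel y₁ y₂ 1 c x z ∂uniform y₁ y₂ = tent c ((x - y₁) / (y₂ - y₁)) := by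
  have hd : 0 < y₂ - y₁ := by linarith
  have hc1 : 0 < 1 - c := by linarith [hc.2]
  have hc0 := hc.1
  have hm : MeasurableSet (proximityRegion y₁ y₂ 1 c x) :=
    measurable_prodMk_left (measurableSet_arc y₁ y₂ 1 c)
  have hiff : (x - y₁) / (y₂ - y₁) < c ↔ x < y₁ + c * (y₂ - y₁) := by
    rw [div_lt_iff₀ hd, sub_lt_iff_lt_add']
  unfold arcKernel
  rw [integral_indicator_one hm]
  by_cases h : x < y₁ + c * (y₂ - y₁)
  · rw [tent, if_pos (hiff.2 h), uniform_real_eq_of_inter_eq (u := y₁) (v := y₁ + (x - y₁) / c) hy]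
    · field_simp; ring
    · have := div_pos (sub_pos.2 hx.1) hc0
      linarith
    · have hv : y₁ + (x - y₁) / c < y₂ := by
        rw [← lt_sub_iff_add_lt', div_lt_iff₀' hc0]; linarith
      ext z
      constructor
      · rintro ⟨hz, hz'⟩
        rw [mem_proximityRegion_iff hc hx hz, if_pos h, ← lt_div_iff₀' hc0] at hz'
        exact ⟨hz.1, by linarith⟩
      · intro hz
        have hz1 : z ∈ Ioo y₁ y₂ := ⟨hz.1, hz.2.trans hv⟩
        refine ⟨hz1, (mem_proximityRegion_iff hc hx hz1).2 ?_⟩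
        rw [if_pos h, ← lt_div_iff₀' hc0]
        linarith [hz.2]
  · rw [tent, if_neg (hiff.not.2 h),
      uniform_real_eq_of_inter_eq (u := y₂ - (y₂ - x) / (1 - c)) (v := y₂) hy]
    · field_simp; ring
    · have := div_pos (sub_pos.2 hx.2) hc1
      linarith
    · have hv : y₁ ≤ y₂ - (y₂ - x) / (1 - c) := by
        rw [le_sub_comm, div_le_iff₀' hc1]; linarith
      ext z
      constructor
      · rintro ⟨hz, hz'⟩
        rw [mem_proximityRegion_iff hc hx hz, if_neg h, ← lt_div_iff₀' hc1] at hz'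
        exact ⟨by linarith, hz.2⟩
      · intro hz
        have hz1 : z ∈ Ioo y₁ y₂ := ⟨hv.trans_lt hz.1, hz.2⟩
        refine ⟨hz1, (mem_proximityRegion_iff hc hx hz1).2 ?_⟩
        rw [if_neg h, ← lt_div_iff₀' hc1]
        linarith [hz.1]

/-- The points whose region contains `x` form one interval around the centre, with ends at distance
`c(x - y₁)` from `y₁` and `(1-c)(y₂ - x)` from `y₂`. -/
lemma integral_arcKernel_right (hy : y₁ < y₂) (hc : c ∈ Ioo (0 : ℝ) 1) {x : ℝ}
    (hx : x ∈ Ioo y₁ y₂) :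
    ∫ z, arcKernel y₁ y₂ 1 c z x ∂uniform y₁ y₂ =
      1 - c * ((x - y₁) / (y₂ - y₁)) - (1 - c) * (1 - (x - y₁) / (y₂ - y₁)) := by
  have hd : 0 < y₂ - y₁ := by linarith
  have hc1 : 0 < 1 - c := by linarith [hc.2]
  have hc0 := hc.1
  have hm : MeasurableSet {z | x ∈ proximityRegion y₁ y₂ 1 c z} :=
    measurable_prodMk_right (measurableSet_arc y₁ y₂ 1 c)
  have e : (fun z => arcKernel y₁ y₂ 1 c z x) =
      {z | x ∈ proximityRegion y₁ y₂ 1 c z}.indicator 1 := rfl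
  have hlo : 0 < c * (x - y₁) := mul_pos hc0 (sub_pos.2 hx.1)
  have hhi : 0 < (1 - c) * (y₂ - x) := mul_pos hc1 (sub_pos.2 hx.2)
  -- The centre lies strictly between the two ends, so the solution sets on its two sides join into
  -- a single interval.
  have hloM : y₁ + c * (x - y₁) < y₁ + c * (y₂ - y₁) := by
    have := mul_pos hc0 (sub_pos.2 hx.2)
    linarith
  have hhiM : y₁ + c * (y₂ - y₁) < y₂ - (1 - c) * (y₂ - x) := by
    have := mul_pos hc1 (sub_pos.2 hx.1)
    linarith
  rw [e, integral_indicator_one hm, uniform_real_eq_of_inter_eq (u := y₁ + c * (x - y₁))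
    (v := y₂ - (1 - c) * (y₂ - x)) hy (hloM.trans hhiM).le]
  · field_simp; ring
  · ext z
    constructor
    · rintro ⟨hz, hz'⟩
      rw [mem_ofPred_eq, mem_proximityRegion_iff hc hz hx] at hz'
      split_ifs at hz' with h <;> constructor <;> linarith
    · intro hz
      have hz1 : z ∈ Ioo y₁ y₂ := ⟨by linarith [hz.1], by linarith [hz.2]⟩
      refine ⟨hz1, (mem_proximityRegion_iff hc hz1 hx).2 ?_⟩
      split_ifs with h
      · linarith [hz.1]
      · linarith [hz.2]

lemma variance_arcKernel_projection (hy : y₁ < y₂) (hc : c ∈ Ioo (0 : ℝ) 1) :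
    Var[fun x => ∫ z, arcKernel y₁ y₂ 1 c x z ∂uniform y₁ y₂ +
      ∫ z, arcKernel y₁ y₂ 1 c z x ∂uniform y₁ y₂; uniform y₁ y₂] = c * (1 - c) / 3 := by
  have := isProbabilityMeasure_uniform hy
  have hae : (fun x => ∫ z, arcKernel y₁ y₂ 1 c x z ∂uniform y₁ y₂ +
      ∫ z, arcKernel y₁ y₂ 1 c z x ∂uniform y₁ y₂) =ᵐ[uniform y₁ y₂]
      fun x => (fun t => tent c t + (1 - c * t - (1 - c) * (1 - t))) ((x - y₁) / (y₂ - y₁)) := by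
    filter_upwards [ae_mem_Ioo_uniform y₁ y₂] with x hx
    rw [integral_arcKernel_left hy hc hx, integral_arcKernel_right hy hc hx]
  have hmem : MemLp (fun x => ∫ z, arcKernel y₁ y₂ 1 c x z ∂uniform y₁ y₂ +
      ∫ z, arcKernel y₁ y₂ 1 c z x ∂uniform y₁ y₂) 2 (uniform y₁ y₂) :=
    MemLp.of_bound ((measurable_integral_left measurable_arcKernel).add
      (measurable_integral_right measurable_arcKernel)).aestronglyMeasurable (1 + 1)
      (ae_of_all _ fun x => (norm_add_le _ _).trans (add_le_add
        (abs_integral_le_of_abs_le (abs_arcKernel_le x))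
        (abs_integral_le_of_abs_le fun z => abs_arcKernel_le z x)))
  rw [variance_eq_sub hmem, integral_congr_ae hae, integral_congr_ae (hae.pow_const 2),
    integral_uniform_comp hy (fun t => tent c t + (1 - c * t - (1 - c) * (1 - t)))]
  simp only [Pi.pow_apply]
  rw [integral_uniform_comp hy (fun t => (tent c t + (1 - c * t - (1 - c) * (1 - t))) ^ 2),
    integral_tent_add_linear hc.1 hc.2, integral_tent_add_linear_sq hc.1 hc.2]
  ring

lemma integral_integral_arcKernel (hy : y₁ < y₂) (hc : c ∈ Ioo (0 : ℝ) 1) :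
    ∫ x, ∫ z, arcKernel y₁ y₂ 1 c x z ∂uniform y₁ y₂ ∂uniform y₁ y₂ = 1 / 2 := by
  rw [← integral_tent hc.1 hc.2, ← integral_uniform_comp hy]
  refine integral_congr_ae ?_
  filter_upwards [ae_mem_Ioo_uniform y₁ y₂] with x hx
  exact integral_arcKernel_left hy hc hx

/-! ### Digraph quantities in terms of the arc kernel -/

lemma arcProbability_eq_integral (hy : y₁ < y₂) :
    arcProbability y₁ y₂ τ c =
      ∫ x, ∫ z, arcKernel y₁ y₂ τ c x z ∂uniform y₁ y₂ ∂uniform y₁ y₂ := by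
  have := isProbabilityMeasure_uniform hy
  rw [arcProbability, ← integral_indicator_one (measurableSet_arc y₁ y₂ τ c), integral_prod]
  · rfl
  · exact Integrable.of_bound
      (measurable_arcKernel (τ := τ) (c := c)).aestronglyMeasurable 1
      (ae_of_all _ fun p => abs_arcKernel_le p.1 p.2)

/-- `halfArcs` is half the symmetrised kernel, so its projection is half the projection sum; the
factor `4` cancels the squared `1/2`. -/
lemma four_mul_arcCovariance (hy : y₁ < y₂) :
    4 * arcCovariance y₁ y₂ τ c =
      Var[fun x => ∫ z, arcKernel y₁ y₂ τ c x z ∂uniform y₁ y₂ +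
        ∫ z, arcKernel y₁ y₂ τ c z x ∂uniform y₁ y₂; uniform y₁ y₂] := by
  have := isProbabilityMeasure_uniform hy
  have hm : Measurable (Function.uncurry (arcKernel y₁ y₂ τ c)) := measurable_arcKernel
  have heq (x z : ℝ) : halfArcs y₁ y₂ τ c x z =
      2⁻¹ * (arcKernel y₁ y₂ τ c x z + arcKernel y₁ y₂ τ c z x) := by
    rw [halfArcs, div_eq_inv_mul]; rfl
  have hhm : Measurable (Function.uncurry (halfArcs y₁ y₂ τ c)) := by
    have e : Function.uncurry (halfArcs y₁ y₂ τ c) = fun p => 2⁻¹ *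
        (Function.uncurry (arcKernel y₁ y₂ τ c) p +
          Function.uncurry (arcKernel y₁ y₂ τ c) p.swap) := funext fun p => heq p.1 p.2
    rw [e]
    exact (hm.add (hm.comp measurable_swap)).const_mul _
  have hb (x z : ℝ) : |halfArcs y₁ y₂ τ c x z| ≤ 1 := by
    have h1 := abs_arcKernel_le (y₁ := y₁) (y₂ := y₂) (τ := τ) (c := c) x z
    have h2 := abs_arcKernel_le (y₁ := y₁) (y₂ := y₂) (τ := τ) (c := c) z x
    rw [abs_le] at *
    rw [heq]
    constructor <;> linarith [h1.1, h1.2, h2.1, h2.2]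
  have hproj : (fun x => ∫ z, halfArcs y₁ y₂ τ c x z ∂uniform y₁ y₂) = fun x => 2⁻¹ *
      (∫ z, arcKernel y₁ y₂ τ c x z ∂uniform y₁ y₂ +
        ∫ z, arcKernel y₁ y₂ τ c z x ∂uniform y₁ y₂) := by
    funext x
    simp_rw [heq]
    rw [integral_const_mul, integral_add]
    · exact Integrable.of_bound (hm.comp measurable_prodMk_left).aestronglyMeasurable 1
        (ae_of_all _ fun z => abs_arcKernel_le x z)
    · exact Integrable.of_bound (hm.comp measurable_prodMk_right).aestronglyMeasurable 1
        (ae_of_all _ fun z => abs_arcKernel_le z x)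
  rw [arcCovariance, covariance_pi_eq_variance_integral hhm hb, hproj, variance_const_mul]
  ring

lemma arcCount_catchDigraph {n : ℕ} (x : Fin n → ℝ) :
    (arcCount (catchDigraph y₁ y₂ τ c x) : ℝ) =
      ∑ p ∈ (Finset.univ : Finset (Fin n)).offDiag, arcKernel y₁ y₂ τ c (x p.1) (x p.2) := by
  classical
  have hset : {p : Fin n × Fin n | (catchDigraph y₁ y₂ τ c x).Adj p.1 p.2} =
      ((Finset.univ : Finset (Fin n)).offDiag.filter
        fun p => x p.2 ∈ proximityRegion y₁ y₂ τ c (x p.1) : Finset (Fin n × Fin n)) := by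
    ext p
    simp [catchDigraph]
  rw [arcCount, hset, Set.ncard_coe_finset, Finset.card_filter, Nat.cast_sum]
  refine Finset.sum_congr rfl fun p _ => ?_
  simp [arcKernel, indicator]

lemma maxArcCount_of_forall_mem {n : ℕ} {x : Fin n → ℝ} (hx : ∀ i, x i ∈ Ioo y₁ y₂) :
    (maxArcCount y₁ y₂ x : ℝ) = n * (n - 1) := by
  have h0 : {k | x k < y₁} = ∅ := by
    ext k; simpa using (hx k).1.le
  have h2 : {k | y₂ < x k} = ∅ := by
    ext k; simpa using (hx k).2.le
  have h1 : {k | y₁ < x k ∧ x k < y₂} = univ := by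
    ext k; simpa using hx k
  have h : maxArcCount y₁ y₂ x = n * (n - 1) := by
    simp [maxArcCount, interval, Fin.sum_univ_three, h0, h1, h2, Set.ncard_univ]
  rw [h]
  -- At `n = 0` the truncated subtraction `0 - 1` is harmless because of the factor `n`.
  rcases n with _ | n <;> simp

lemma relativeDensity_of_forall_mem {n : ℕ} {x : Fin n → ℝ} (hx : ∀ i, x i ∈ Ioo y₁ y₂) :
    relativeDensity y₁ y₂ τ c x = pairAverage (arcKernel y₁ y₂ τ c) x := by
  rw [relativeDensity, arcCount_catchDigraph, maxArcCount_of_forall_mem hx, pairAverage]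

end CentralSimilarity

theorem mainTheorem6 (y₁ y₂ : ℝ) (hy : y₁ < y₂) (c : ℝ) (hc : c ∈ Ioo (0 : ℝ) 1)
    {Ω : ℕ → Type*} [∀ n, MeasurableSpace (Ω n)]
    (P : (n : ℕ) → Measure (Ω n)) [∀ n, IsProbabilityMeasure (P n)]
    (X : (n : ℕ) → Fin n → Ω n → ℝ)
    (hlaw : ∀ n i, HasLaw (X n i) (CentralSimilarity.uniform y₁ y₂) (P n))
    (hindep : ∀ n, iIndepFun (X n) (P n)) :
    CentralSimilarity.arcProbability y₁ y₂ 1 c = 1 / 2 ∧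
    4 * CentralSimilarity.arcCovariance y₁ y₂ 1 c = c * (1 - c) / 3 ∧
    TendstoInDistribution
      (fun (n : ℕ) (ω : Ω n) => √(n : ℝ) *
        (CentralSimilarity.relativeDensity y₁ y₂ 1 c (fun i => X n i ω) -
          CentralSimilarity.arcProbability y₁ y₂ 1 c))
      atTop (id : ℝ → ℝ) P
      (gaussianReal 0 (4 * CentralSimilarity.arcCovariance y₁ y₂ 1 c).toNNReal) := by
  have := CentralSimilarity.isProbabilityMeasure_uniform hy
  refine ⟨?_, ?_, ?_⟩
  · rw [CentralSimilarity.arcProbability_eq_integral hy,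
      CentralSimilarity.integral_integral_arcKernel hy hc]
  · rw [CentralSimilarity.four_mul_arcCovariance hy,
      CentralSimilarity.variance_arcKernel_projection hy hc]
  · refine (tendstoInDistribution_sqrt_mul_pairAverage_sub_of_array
      CentralSimilarity.measurable_arcKernel CentralSimilarity.abs_arcKernel_le P X hlaw hindep
      (CentralSimilarity.four_mul_arcCovariance hy).symm).congr (fun n => ?_) (ae_eq_refl _)
    -- Identifying the relative density with the U-statistic requires all points in the middle
    -- interval, which holds only almost surely.
    have hae : ∀ᵐ ω ∂P n, ∀ i, X n i ω ∈ Ioo y₁ y₂ := by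
      refine ae_all_iff.2 fun i => ?_
      refine ((hlaw n i).ae_iff (p := fun x => x ∈ Ioo y₁ y₂) ?_).2
        (CentralSimilarity.ae_mem_Ioo_uniform y₁ y₂)
      exact measurableSet_setOfPred.1 measurableSet_Ioo
    filter_upwards [hae] with ω hω
    rw [CentralSimilarity.relativeDensity_of_forall_mem hω,
      CentralSimilarity.arcProbability_eq_integral hy]
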